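/- For $n\ge 0$, consider the $n$-step walks on $\mathbb{Z}^2$ that start at the origin, take their steps in $\mathcal S=\{(0,1),(0,-1),(1,0),(-1,0),(1,1),(-1,-1)\}$ (that is, N, S, E, W, NE, SW: the double Kreweras model) and whose positions all lie in the quadrant $\{(i,j): i\ge 0,\ j\ge 0\}$. Let $q(i,j;n)$ be the number of those that end at $(i,j)$, and let $$Q(x,y;t)=\sum_{n\ge 0}\sum_{i,j\ge 0} q(i,j;n)\,x^iy^jt^n .$$ There is exactly one formal power series $N\equiv N(t)\in\mathbb{Q}[[t]]$ such that $$N=t\,(1+2N+4N^2).$$ Up to a factor $t$, it is the generating function of the numbers $2^nM_n$, where $M_n$ is the $n$th Motzkin number ($M_0=1$ and $M_{n+1}=M_n+\sum_{i=0}^{n-1}M_iM_{n-1-i}$): $$N=\sum_{n\ge 0}2^nM_n\,t^{n+1}=\sum_{n\ge 0}t^{n+1}\sum_{k=0}^{\lfloor n/2\rfloor}\frac{2^n}{k+1}\binom{n}{2k}\binom{2k}{k}.$$ Moreover, as identities of formal Laurent series in $t$, the generating function of all walks of the model is $$Q(1,1;t)=\frac1{2t}\left(\sqrt{\frac{1+2N}{1-2N}}-1\right),$$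 and the generating function of the walks of the model that end at the origin is $$Q(0,0;t)=\frac{(1+4N)^{3/2}}{2Nt}-\frac1{2t^2}-\frac2t .$$ Here, for a power series $F$ with constant term $1$ and a rational number $r$, $F^r=\sum_{n\ge0}\binom rn(F-1)^n$, and $\sqrt F=F^{1/2}$. -/

import Mathlib

open scoped PowerSeries LaurentSeries

/-- The `i`-th position (the sum of the first `i` steps) of the walk from the origin
with steps `w 0, …, w (n - 1)`. -/
def walkPosition {n : ℕ} (w : Fin n → ℤ × ℤ) (i : ℕ) : ℤ × ℤ :=
  ∑ k ∈ Finset.univ.filter (fun k : Fin n => (k : ℕ) < i), w k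

/-- The `n`-step walks with steps in `S` that start at the origin and stay in the
quarter plane `{(a, b) | 0 ≤ a, 0 ≤ b}`. -/
def quadrantWalks (S : Finset (ℤ × ℤ)) (n : ℕ) : Finset (Fin n → ℤ × ℤ) :=
  (Fintype.piFinset (fun _ : Fin n => S)).filter fun w : Fin n → ℤ × ℤ =>
    ∀ i : Fin (n + 1), 0 ≤ (walkPosition w i).1 ∧ 0 ≤ (walkPosition w i).2

/-- The generating function `Q(x, y; t)` of quarter plane walks with steps in `S`, as a power
series in `t` with coefficients in `ℚ[x, y]`: a walk of length `n` ending at `(i, j)` contributes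
`x ^ i * y ^ j * t ^ n`. The variables `x`, `y` are those of index `0`, `1`; the coordinates of
endpoints are nonnegative, so that `Int.toNat` does not change them. -/
noncomputable def quadrantGF (S : Finset (ℤ × ℤ)) : (MvPolynomial (Fin 2) ℚ)⟦X⟧ :=
  PowerSeries.mk fun n => ∑ w ∈ quadrantWalks S n,
    MvPolynomial.X 0 ^ (walkPosition w n).1.toNat * MvPolynomial.X 1 ^ (walkPosition w n).2.toNat

/-- The specialization `Q(a, b; t)` of `Q(x, y; t)`, for rational numbers `a`, `b`. -/
noncomputable def quadrantGFAt (S : Finset (ℤ × ℤ)) (a b : ℚ) : ℚ⟦X⟧ :=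
  PowerSeries.map (MvPolynomial.eval ![a, b]) (quadrantGF S)

/-- The step set of the double Kreweras model: N, S, E, W, NE, SW. -/
def doubleKrewerasSteps : Finset (ℤ × ℤ) :=
  {(0, 1), (0, -1), (1, 0), (-1, 0), (1, 1), (-1, -1)}

/-- The Motzkin numbers `1, 1, 2, 4, 9, 21, 51, …`, by the recurrence
`M (n + 1) = M n + ∑_{i < n} M i * M (n - 1 - i)`. -/
def motzkin : ℕ → ℕ
  | 0 => 1
  | n + 1 => motzkin n + ∑ i : Fin n, motzkin i * motzkin (n - 1 - i)

/-- The power `F ^ r`, for a power series `F` with constant term `1` and a rational exponent `r`: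
`F ^ r = ∑ₙ (r choose n) (F - 1) ^ n`. -/
noncomputable def powerSeriesRPow (F : ℚ⟦X⟧) (r : ℚ) : ℚ⟦X⟧ :=
  (PowerSeries.binomialSeries ℚ r).subst (F - 1)

/-- The square root with constant term `1` of a power series with constant term `1`. -/
noncomputable def powerSeriesSqrt (F : ℚ⟦X⟧) : ℚ⟦X⟧ :=
  powerSeriesRPow F (1 / 2)

/-! ### Quadratic equations and square roots in rings of power series -/

section PowerSeriesTools

open PowerSeries

/-! The proof is the half-orbit form of the kernel method. Write x̄ = 1/x, ȳ = 1/y, and let K be the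
kernel. Among the six pairs in the orbit of (x, y), the alternating sum over (x, y), (x̄ȳ, y), (x̄ȳ,
x) cancels every boundary unknown that involves y. Dividing by K and taking the constant term in y
leaves only the diagonal series in x̄, the axis series in x and the excursion series
(`half_orbit_equation`). The constant term is taken through a functional on powers of y
(`kernelWeight`), so K is never inverted.

The square root of the discriminant splits as c·P(x)·P(x̄) (`kernelSqrt_factorization`). Dividing by
P(x) separates nonnegative from negative powers of x, and the nonnegative part (`axis_equation`)
relates the axis and excursion series alone. At x = -1 the axis series drops out, which gives the
excursions. At x = 1 one gets the axis total, hence the total number of walks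
(`excursion_and_total_equations`).

All coefficients become rational in J, where N = J² - J. The final radicals are recognised by their
squares and constant terms. The Motzkin formulas follow from uniqueness of the solution of the
quadratic equation. -/

theorem PowerSeries.eq_zero_of_eq_X_mul {R : Type*} [CommRing R] (E : ℕ → R⟦X⟧)
    (h : ∀ k, E k = X * E (k + 1)) (k : ℕ) : E k = 0 := by
  have key : ∀ m k, coeff m (E k) = 0 := by
    intro m
    induction m with
    | zero => intro k; rw [h k]; simp
    | succ m ih => intro k; rw [h k, coeff_succ_X_mul]; exact ih _
  ext m
  simpa using key m k

/-- The difference u of two solutions satisfies u = X v u for some series v. Iterating makes u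
divisible by every power of X. -/
theorem PowerSeries.quadratic_fixedPoint_unique {R : Type*} [CommRing R] {a b c Y Y' : R⟦X⟧}
    (h : Y = X * (a + b * Y + c * Y ^ 2)) (h' : Y' = X * (a + b * Y' + c * Y' ^ 2)) : Y = Y' := by
  have hu : Y - Y' = X * ((b + c * (Y + Y')) * (Y - Y')) := by linear_combination h - h'
  have := PowerSeries.eq_zero_of_eq_X_mul
    (fun k => (b + c * (Y + Y')) ^ k * (Y - Y')) (fun k => by
      linear_combination (b + c * (Y + Y')) ^ k * hu) 0
  simpa [sub_eq_zero] using this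

/-- The coefficients of the solution of `Y = X * (a + b * Y + c * Y ^ 2)`. -/
noncomputable def quadraticFixedPointCoeff {R : Type*} [CommRing R] (a b c : R⟦X⟧) : ℕ → R
  | 0 => 0
  | n + 1 =>
    let Y : R⟦X⟧ := PowerSeries.mk fun k =>
      if _h : k < n + 1 then quadraticFixedPointCoeff a b c k else 0
    coeff n (a + b * Y + c * Y ^ 2)

theorem PowerSeries.exists_quadratic_fixedPoint {R : Type*} [CommRing R] (a b c : R⟦X⟧) :
    ∃ Y : R⟦X⟧, Y = X * (a + b * Y + c * Y ^ 2) := by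
  refine ⟨mk (quadraticFixedPointCoeff a b c), ?_⟩
  ext n
  cases n with
  | zero => simp [quadraticFixedPointCoeff]
  | succ n =>
    rw [coeff_succ_X_mul, coeff_mk, quadraticFixedPointCoeff]
    -- The recursion truncates the series after degree n so that it is well founded. The factor X
    -- makes coefficient n + 1 depend on degrees at most n only.
    have htr : ∀ k ≤ n, coeff k (mk fun k =>
        if _h : k < n + 1 then quadraticFixedPointCoeff a b c k else 0) =
        coeff k (mk (quadraticFixedPointCoeff a b c)) := by
      intro k hk
      rw [coeff_mk, coeff_mk, dif_pos (Nat.lt_succ_of_le hk)]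
    have hmul : ∀ f g g' : R⟦X⟧, (∀ k ≤ n, coeff k g = coeff k g') →
        ∀ k ≤ n, coeff k (f * g) = coeff k (f * g') := by
      intro f g g' hg k hk
      rw [coeff_mul, coeff_mul]
      refine Finset.sum_congr rfl fun p hp => ?_
      rw [hg p.2 (le_trans (Finset.HasAntidiagonal.mem_antidiagonal.mp hp ▸ Nat.le_add_left _ _) hk)]
    simp only [map_add, pow_two]
    congr 1
    · rw [hmul _ _ _ htr n le_rfl]
    · rw [← mul_assoc, ← mul_assoc, hmul _ _ _ htr n le_rfl, mul_right_comm,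
        hmul _ _ _ htr n le_rfl, mul_right_comm]

theorem PowerSeries.constantCoeff_map_apply {R S : Type*} [Semiring R] [Semiring S] (f : R →+* S)
    (F : R⟦X⟧) : constantCoeff (PowerSeries.map f F) = f (constantCoeff F) := by
  rw [← coeff_zero_eq_constantCoeff_apply, coeff_map, coeff_zero_eq_constantCoeff_apply]

theorem PowerSeries.eq_of_sq_eq_sq {R : Type*} [CommRing R] [IsDomain R] [CharZero R] {F G : R⟦X⟧}
    (h : F ^ 2 = G ^ 2) (hF : constantCoeff F = 1) (hG : constantCoeff G = 1) : F = G := by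
  rcases sq_eq_sq_iff_eq_or_eq_neg.mp h with h | h
  · exact h
  · exfalso
    have := congrArg constantCoeff h
    rw [map_neg, hF, hG] at this
    have h2 : (2 : R) = 0 := by linear_combination this
    exact two_ne_zero h2

/-! ### Square roots via the binomial series -/

section RPow

variable {R : Type*} [CommRing R] [Algebra ℚ R] {F : R⟦X⟧}

theorem constantCoeff_binomialSeries_subst (hF : constantCoeff F = 1) (r : ℚ) :
    constantCoeff ((PowerSeries.binomialSeries ℚ r).subst (F - 1) : R⟦X⟧) = 1 := by
  have h0 : constantCoeff (F - 1) = 0 := by rw [map_sub, hF, map_one, sub_self]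
  have hs : HasSubst (F - 1) := HasSubst.of_constantCoeff_zero' h0
  have h1 : PowerSeries.binomialSeries ℚ r = 1 + (PowerSeries.binomialSeries ℚ r - 1) := by ring
  rw [h1, subst_add hs, ← coe_substAlgHom hs, map_one, map_add, coe_substAlgHom hs, map_one]
  have := constantCoeff_subst_eq_zero (a := F - 1) h0 (PowerSeries.binomialSeries ℚ r - 1)
    (by simp)
  erw [this, add_zero]

/-- Exponents of binomial series add under multiplication, and a natural exponent gives an honest
power of 1 + X. This characterises half-integer powers by their squares. -/
theorem binomialSeries_subst_sq (hF : constantCoeff F = 1) {r : ℚ} {d : ℕ} (hr : r + r = d) :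
    ((PowerSeries.binomialSeries ℚ r).subst (F - 1) : R⟦X⟧) ^ 2 = F ^ d := by
  have hs : HasSubst (F - 1) :=
    HasSubst.of_constantCoeff_zero' (by rw [map_sub, hF, map_one, sub_self])
  rw [pow_two, ← subst_mul hs, ← binomialSeries_add, hr, binomialSeries_nat,
    subst_pow hs, subst_add hs, subst_X hs, ← coe_substAlgHom hs, map_one]
  ring

theorem PowerSeries.exists_sqrt (hF : constantCoeff F = 1) :
    ∃ P : R⟦X⟧, P ^ 2 = F ∧ constantCoeff P = 1 :=
  ⟨(PowerSeries.binomialSeries ℚ (1 / 2 : ℚ)).subst (F - 1),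
    by rw [binomialSeries_subst_sq hF (d := 1) (by norm_num), pow_one],
    constantCoeff_binomialSeries_subst hF _⟩

end RPow

theorem constantCoeff_powerSeriesRPow {F : ℚ⟦X⟧} (hF : constantCoeff F = 1) (r : ℚ) :
    constantCoeff (powerSeriesRPow F r) = 1 :=
  constantCoeff_binomialSeries_subst hF r

theorem powerSeriesRPow_sq {F : ℚ⟦X⟧} (hF : constantCoeff F = 1) {r : ℚ} {d : ℕ}
    (hr : r + r = d) : powerSeriesRPow F r ^ 2 = F ^ d :=
  binomialSeries_subst_sq hF hr

end PowerSeriesTools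

/-! ### Motzkin numbers -/

section Motzkin

open PowerSeries

/-- The generating function of the Motzkin numbers, scaled by powers of two. -/
noncomputable def motzkinSeries : ℚ⟦X⟧ :=
  PowerSeries.mk fun n : ℕ => (2 : ℚ) ^ n * (motzkin n : ℚ)

theorem motzkinSeries_eq :
    motzkinSeries = 1 + 2 * (X * motzkinSeries) + 4 * (X * motzkinSeries) ^ 2 := by
  have h2 : (2 : ℚ⟦X⟧) = C 2 := (map_ofNat C 2).symm
  have h4 : (4 : ℚ⟦X⟧) = C 4 := (map_ofNat C 4).symm
  rw [mul_pow, pow_two X, mul_assoc X X, h2, h4]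
  ext n
  rcases n with _ | _ | n
  · simp [motzkinSeries, motzkin, coeff_zero_eq_constantCoeff]
  · simp [motzkinSeries, motzkin, coeff_C_mul, coeff_succ_X_mul, coeff_one, coeff_zero_X_mul]
  · rw [map_add, map_add, coeff_C_mul, coeff_C_mul, coeff_succ_X_mul, coeff_succ_X_mul,
      coeff_succ_X_mul, pow_two, coeff_mul, coeff_one, if_neg (Nat.succ_ne_zero _)]
    simp only [motzkinSeries, coeff_mk]
    rw [motzkin, Finset.Nat.sum_antidiagonal_eq_sum_range_succ
      (fun i j => (2 : ℚ) ^ i * (motzkin i : ℚ) * ((2 : ℚ) ^ j * (motzkin j : ℚ))),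
      Fin.sum_univ_eq_sum_range (fun i => motzkin i * motzkin (n + 1 - 1 - i))]
    push_cast
    rw [mul_add, Finset.mul_sum, Finset.mul_sum, zero_add]
    congr 1
    · ring
    · refine Finset.sum_congr rfl fun i hi => ?_
      -- The truncated subtraction is exact here, so 2^(n+2) splits as 4·2^i·2^(n-i).
      have : i + (n - i) = n := by have := Finset.mem_range.mp hi; omega
      have e : (2 : ℚ) ^ (n + 1 + 1) = 4 * (2 ^ i * 2 ^ (n - i)) := by
        rw [← pow_add, this]; ring
      rw [e]; ring

theorem X_mul_motzkinSeries_fixedPoint :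
    X * motzkinSeries =
      X * (1 + 2 * (X * motzkinSeries) + 4 * (X * motzkinSeries) ^ 2) := by
  rw [← motzkinSeries_eq]

theorem coeff_X_pow_mul_inv_one_sub_pow (k n : ℕ) :
    coeff n ((X : ℚ⟦X⟧) ^ (2 * k) * (PowerSeries.mk 1 : ℚ⟦X⟧) ^ (2 * k + 1)) =
      n.choose (2 * k) := by
  rw [coeff_X_pow_mul', mk_one_pow_eq_mk_choose_add, coeff_mk]
  split_ifs with h
  · rw [Nat.add_sub_cancel' h]
  · rw [Nat.choose_eq_zero_of_lt (by omega)]; simp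

/-- Summing over n first, the terms with fixed k give X^(2k)/(1-X)^(2k+1). Hence M = A(u)/(1-X),
with A the Catalan series and u = (X/(1-X))², and A = 1 + uA² becomes the Motzkin equation. -/
theorem exists_mk_sum_choose_catalan_eq :
    let M : ℚ⟦X⟧ := PowerSeries.mk fun n : ℕ =>
      ∑ k ∈ Finset.range (n / 2 + 1), (n.choose (2 * k) : ℚ) * (catalan k : ℚ)
    M = 1 + X * M + (X * M) ^ 2 := by
  intro M
  set I : ℚ⟦X⟧ := PowerSeries.mk 1 with hI
  have hI1 : I * (1 - X) = 1 := mk_one_mul_one_sub_eq_one ℚ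
  set u : ℚ⟦X⟧ := X ^ 2 * I ^ 2 with hu
  have hs : HasSubst u := HasSubst.of_constantCoeff_zero' (by simp [hu])
  set A : ℚ⟦X⟧ := PowerSeries.map (Nat.castRingHom ℚ) catalanSeries with hA
  have hA1 : A ^ 2 * X + 1 = A := by
    have := congrArg (PowerSeries.map (Nat.castRingHom ℚ)) catalanSeries_sq_mul_X_add_one
    simpa using this
  have hM : M = I * A.subst u := by
    ext n
    rw [coeff_mul]
    -- Since u^d is divisible by X^(2d), only d ≤ n/2 contributes, and the substitution is a finite
    -- sum.
    have hfin : ∀ m ≤ n, coeff m (A.subst u) =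
        ∑ d ∈ Finset.range (n / 2 + 1), (catalan d : ℚ) * coeff m (u ^ d) := by
      intro m hm
      rw [coeff_subst' hs, finsum_eq_sum_of_support_subset]
      · refine Finset.sum_congr rfl fun d _ => ?_
        simp [hA]
      · intro d hd
        rw [Finset.coe_range, Set.mem_Iio]
        by_contra hlt
        refine hd ?_
        show coeff d A • coeff m (u ^ d) = 0
        rw [hu, mul_pow, ← pow_mul, ← pow_mul, coeff_X_pow_mul', if_neg (by omega), smul_zero]
    have : ∑ p ∈ Finset.HasAntidiagonal.antidiagonal n, coeff p.1 I * coeff p.2 (A.subst u) =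
        ∑ d ∈ Finset.range (n / 2 + 1), (catalan d : ℚ) * coeff n (I * u ^ d) := by
      simp_rw [coeff_mul, Finset.mul_sum]
      rw [Finset.sum_comm]
      refine Finset.sum_congr rfl fun p hp => ?_
      rw [hfin p.2 (Finset.HasAntidiagonal.mem_antidiagonal.mp hp ▸ Nat.le_add_left _ _),
        Finset.mul_sum]
      exact Finset.sum_congr rfl fun d _ => by ring
    rw [this, coeff_mk]
    refine Finset.sum_congr rfl fun d _ => ?_
    rw [← coeff_X_pow_mul_inv_one_sub_pow d n, mul_comm, hu, mul_pow, ← pow_mul, ← pow_mul, hI]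
    congr 2
    ring
  have hA2 : (A.subst u) ^ 2 * u + 1 = A.subst u := by
    have := congrArg (fun f : ℚ⟦X⟧ => (f.subst u : ℚ⟦X⟧)) hA1
    rw [subst_add hs, subst_mul hs, subst_pow hs, subst_X hs] at this
    rw [← coe_substAlgHom hs, map_one] at this
    rwa [← coe_substAlgHom hs]
  rw [hM]
  generalize A.subst u = B at hA2
  rw [hu] at hA2
  linear_combination B * hI1 - hA2

theorem mk_closedForm_eq_motzkinSeries :
    (PowerSeries.mk fun n : ℕ => ∑ k ∈ Finset.range (n / 2 + 1),
        (2 : ℚ) ^ n / ((k : ℚ) + 1) * (n.choose (2 * k) : ℚ) * ((2 * k).choose k : ℚ)) =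
      motzkinSeries := by
  set M : ℚ⟦X⟧ := PowerSeries.mk fun n : ℕ =>
    ∑ k ∈ Finset.range (n / 2 + 1), (n.choose (2 * k) : ℚ) * (catalan k : ℚ) with hM
  have hM1 : M = 1 + X * M + (X * M) ^ 2 := exists_mk_sum_choose_catalan_eq
  have h1 : (PowerSeries.mk fun n : ℕ => ∑ k ∈ Finset.range (n / 2 + 1),
      (2 : ℚ) ^ n / ((k : ℚ) + 1) * (n.choose (2 * k) : ℚ) * ((2 * k).choose k : ℚ)) =
      rescale 2 M := by
    ext n
    rw [coeff_rescale, coeff_mk, hM, coeff_mk, Finset.mul_sum]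
    refine Finset.sum_congr rfl fun k _ => ?_
    have hc : ((k : ℚ) + 1) * catalan k = ((2 * k).choose k : ℚ) := by
      have := succ_mul_catalan_eq_centralBinom k
      rw [Nat.centralBinom] at this
      exact_mod_cast this
    rw [← hc]
    have : (k : ℚ) + 1 ≠ 0 := by positivity
    field_simp
  rw [h1]
  have h2 : rescale 2 M = 1 + 2 * (X * rescale 2 M) + 4 * (X * rescale 2 M) ^ 2 := by
    have := congrArg (rescale (2 : ℚ)) hM1
    rw [map_add, map_add, map_pow, map_mul, rescale_X, map_one] at this
    have h2 : (2 : ℚ⟦X⟧) = C 2 := (map_ofNat C 2).symm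
    have h4 : (4 : ℚ⟦X⟧) = C 2 * C 2 := by
      rw [← map_mul, ← map_ofNat C 4]; norm_num
    rw [h4, h2]
    linear_combination this
  have h3 := PowerSeries.quadratic_fixedPoint_unique
    (congrArg (X * ·) h2) X_mul_motzkinSeries_fixedPoint
  exact mul_left_cancel₀ X_ne_zero h3

end Motzkin

/-! ### Sums over quadrant walks -/

section Walks

theorem walkPosition_snoc_of_le {n : ℕ} (w : Fin n → ℤ × ℤ) (s : ℤ × ℤ) {i : ℕ} (hi : i ≤ n) :
    walkPosition (Fin.snoc (α := fun _ => ℤ × ℤ) w s) i = walkPosition w i := by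
  simp only [walkPosition, Finset.sum_filter, Fin.sum_univ_castSucc, Fin.snoc_castSucc,
    Fin.snoc_last, Fin.val_castSucc, Fin.val_last]
  rw [if_neg (by omega), add_zero]

theorem walkPosition_snoc_last {n : ℕ} (w : Fin n → ℤ × ℤ) (s : ℤ × ℤ) :
    walkPosition (Fin.snoc (α := fun _ => ℤ × ℤ) w s) (n + 1) = walkPosition w n + s := by
  simp only [walkPosition, Finset.sum_filter, Fin.sum_univ_castSucc, Fin.snoc_castSucc,
    Fin.snoc_last, Fin.val_castSucc, Fin.val_last]
  rw [if_pos (by omega)]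
  congr 1
  refine Finset.sum_congr rfl fun k _ => ?_
  rw [if_pos k.is_lt, if_pos (by omega)]

theorem mem_quadrantWalks {S : Finset (ℤ × ℤ)} {n : ℕ} {w : Fin n → ℤ × ℤ} :
    w ∈ quadrantWalks S n ↔ (∀ k, w k ∈ S) ∧
      ∀ i ≤ n, 0 ≤ (walkPosition w i).1 ∧ 0 ≤ (walkPosition w i).2 := by
  rw [quadrantWalks, Finset.mem_filter, Fintype.mem_piFinset]
  refine and_congr_right fun _ => ⟨fun h i hi => h ⟨i, by omega⟩, fun h i => h i (by omega)⟩

theorem snoc_mem_quadrantWalks {S : Finset (ℤ × ℤ)} {n : ℕ} {w : Fin n → ℤ × ℤ} {s : ℤ × ℤ} :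
    Fin.snoc (α := fun _ => ℤ × ℤ) w s ∈ quadrantWalks S (n + 1) ↔
      w ∈ quadrantWalks S n ∧ s ∈ S ∧
        0 ≤ (walkPosition w n + s).1 ∧ 0 ≤ (walkPosition w n + s).2 := by
  simp only [mem_quadrantWalks, Fin.forall_fin_succ', Fin.snoc_castSucc, Fin.snoc_last]
  constructor
  · rintro ⟨⟨h1, h2⟩, h3⟩
    refine ⟨⟨h1, fun i hi => ?_⟩, h2, ?_⟩
    · rw [← walkPosition_snoc_of_le w s hi]; exact h3 i (by omega)
    · rw [← walkPosition_snoc_last]; exact h3 _ le_rfl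
  · rintro ⟨⟨h1, h2⟩, h3, h4⟩
    refine ⟨⟨h1, h3⟩, fun i hi => ?_⟩
    rcases Nat.lt_or_ge n i with h | h
    · obtain rfl : i = n + 1 := by omega
      rw [walkPosition_snoc_last]; exact h4
    · rw [walkPosition_snoc_of_le w s h]; exact h2 i h

/-- The sum of `g` over the endpoints of the `n`-step quadrant walks with steps in `S`. -/
def walkSum {M : Type*} [AddCommMonoid M] (S : Finset (ℤ × ℤ)) (n : ℕ) (g : ℤ × ℤ → M) : M :=
  ∑ w ∈ quadrantWalks S n, g (walkPosition w n)

/-- The sum of `g` over the points of the quadrant that can be reached from `p` in one step. -/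
def stepSum {M : Type*} [AddCommMonoid M] (S : Finset (ℤ × ℤ)) (g : ℤ × ℤ → M) (p : ℤ × ℤ) : M :=
  ∑ s ∈ S, if 0 ≤ (p + s).1 ∧ 0 ≤ (p + s).2 then g (p + s) else 0

variable {M : Type*} [AddCommMonoid M] (S : Finset (ℤ × ℤ))

theorem walkSum_zero (g : ℤ × ℤ → M) : walkSum S 0 g = g (0, 0) := by
  have h : quadrantWalks S 0 = {Fin.elim0} := by
    ext w
    rw [Finset.mem_singleton, mem_quadrantWalks]
    refine ⟨fun _ => Subsingleton.elim _ _, fun _ => ⟨fun k => k.elim0, fun i _ => ?_⟩⟩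
    simp [walkPosition]
  rw [walkSum, h, Finset.sum_singleton]
  rfl

/-- Splitting off the last step transfers it to the test function. Functional equations for walks
thus reduce to pointwise identities at an endpoint. -/
theorem walkSum_succ (n : ℕ) (g : ℤ × ℤ → M) :
    walkSum S (n + 1) g = walkSum S n (stepSum S g) := by
  simp only [walkSum, stepSum, ← Finset.sum_filter]
  rw [Finset.sum_sigma']
  refine (Finset.sum_bij' (fun p _ => Fin.snoc (α := fun _ => ℤ × ℤ) p.1 p.2)
    (fun w _ => ⟨Fin.init w, w (Fin.last n)⟩) ?_ ?_ ?_ ?_ ?_).symm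
  · rintro ⟨w, s⟩ h
    rw [Finset.mem_sigma, Finset.mem_filter] at h
    exact snoc_mem_quadrantWalks.mpr h
  · intro w h
    rw [← Fin.snoc_init_self w] at h
    rw [Finset.mem_sigma, Finset.mem_filter]
    exact snoc_mem_quadrantWalks.mp h
  · rintro ⟨w, s⟩ _
    simp
  · intro w _
    exact Fin.snoc_init_self w
  · rintro ⟨w, s⟩ _
    rw [walkPosition_snoc_last]

theorem walkSum_congr {n : ℕ} {g g' : ℤ × ℤ → M} (h : ∀ i j : ℕ, g (i, j) = g' (i, j)) :
    walkSum S n g = walkSum S n g' := by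
  refine Finset.sum_congr rfl fun w hw => ?_
  obtain ⟨h1, h2⟩ := (mem_quadrantWalks.mp hw).2 n le_rfl
  have := h (walkPosition w n).1.toNat (walkPosition w n).2.toNat
  rwa [Int.toNat_of_nonneg h1, Int.toNat_of_nonneg h2] at this

theorem walkSum_add (n : ℕ) (g g' : ℤ × ℤ → M) :
    walkSum S n (fun p => g p + g' p) = walkSum S n g + walkSum S n g' :=
  Finset.sum_add_distrib

theorem map_walkSum {N F : Type*} [AddCommMonoid N] [FunLike F M N] [AddMonoidHomClass F M N]
    (f : F) (n : ℕ) (g : ℤ × ℤ → M) : f (walkSum S n g) = walkSum S n (fun p => f (g p)) :=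
  map_sum f _ _

theorem walkSum_swap (hS : ∀ s : ℤ × ℤ, s ∈ S → s.swap ∈ S) (n : ℕ) (g : ℤ × ℤ → M) :
    walkSum S n (fun p => g p.swap) = walkSum S n g := by
  induction n generalizing g with
  | zero => rw [walkSum_zero, walkSum_zero]; rfl
  | succ n ih =>
    rw [walkSum_succ, walkSum_succ, ← ih (stepSum S g)]
    congr 1
    funext p
    refine Finset.sum_bij' (fun s _ => s.swap) (fun s _ => s.swap) (fun s h => hS s h)
      (fun s h => hS s h) (fun s _ => rfl) (fun s _ => rfl) fun s _ => ?_
    simp only [← Prod.swap_add, Prod.fst_swap, Prod.snd_swap, and_comm]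

theorem walkSum_sub {M : Type*} [AddCommGroup M] (n : ℕ) (g g' : ℤ × ℤ → M) :
    walkSum S n (fun p => g p - g' p) = walkSum S n g - walkSum S n g' :=
  Finset.sum_sub_distrib _ _

theorem mul_walkSum {R : Type*} [NonUnitalNonAssocSemiring R] (a : R) (n : ℕ) (g : ℤ × ℤ → R) :
    a * walkSum S n g = walkSum S n (fun p => a * g p) :=
  Finset.mul_sum _ _ _

theorem coeff_quadrantGFAt (a b : ℚ) (n : ℕ) :
    PowerSeries.coeff n (quadrantGFAt S a b) =
      walkSum S n (fun p => a ^ p.1.toNat * b ^ p.2.toNat) := by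
  rw [quadrantGFAt, PowerSeries.coeff_map, quadrantGF, PowerSeries.coeff_mk, map_sum, walkSum]
  simp

end Walks

/-! ### The step operator of the double Kreweras model -/

section DoubleKreweras

theorem swap_mem_doubleKrewerasSteps (s : ℤ × ℤ) (hs : s ∈ doubleKrewerasSteps) :
    s.swap ∈ doubleKrewerasSteps := by
  simp only [doubleKrewerasSteps, Finset.mem_insert, Finset.mem_singleton] at hs ⊢
  rcases hs with rfl | rfl | rfl | rfl | rfl | rfl <;> simp

/-- The sum of `g` over the six neighbours of `(i, j)` in the double Kreweras model. -/
def doubleKrewerasNeighborSum {M : Type*} [AddCommMonoid M] (g : ℤ × ℤ → M) (i j : ℤ) : M :=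
  g (i, j + 1) + g (i, j - 1) + g (i + 1, j) + g (i - 1, j) + g (i + 1, j + 1) + g (i - 1, j - 1)

/-- Inclusion-exclusion: S and SW leave the quadrant from the bottom edge, W and SW from the left
edge, and SW is subtracted twice at the origin. -/
theorem stepSum_doubleKreweras {M : Type*} [AddCommGroup M] (g : ℤ × ℤ → M) (i j : ℕ) :
    stepSum doubleKrewerasSteps g (i, j) =
      doubleKrewerasNeighborSum g i j
      - (if j = 0 then g (i, -1) + g (i - 1, -1) else 0)
      - (if i = 0 then g (-1, j) + g (-1, j - 1) else 0)
      + (if i = 0 ∧ j = 0 then g (-1, -1) else 0) := by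
  have h0 : stepSum doubleKrewerasSteps g (i, j) =
      g (i, j + 1) + (if j = 0 then 0 else g (i, j - 1)) + g (i + 1, j) +
      (if i = 0 then 0 else g (i - 1, j)) + g (i + 1, j + 1) +
      (if i = 0 ∨ j = 0 then 0 else g (i - 1, j - 1)) := by
    simp only [stepSum, doubleKrewerasSteps]
    rw [Finset.sum_insert (by decide), Finset.sum_insert (by decide), Finset.sum_insert (by decide),
      Finset.sum_insert (by decide), Finset.sum_insert (by decide), Finset.sum_singleton]
    simp only [Prod.mk_add_mk, add_zero, ← sub_eq_add_neg]
    rcases i with _ | i <;> rcases j with _ | j <;> simp <;> (try split_ifs) <;> first | omega | abel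
  rw [h0, doubleKrewerasNeighborSum]
  rcases i with _ | i <;> rcases j with _ | j <;> simp <;> abel

end DoubleKreweras

/-! ### The kernel method: the half-orbit equation -/

section KernelMethod

open PowerSeries

variable {R : Type*} [CommRing R] (x : Rˣ)

/-- The power `x ^ k` of a unit, as a constant power series. -/
noncomputable def unitPow (k : ℤ) : R⟦X⟧ := C ((x ^ k : Rˣ) : R)

theorem unitPow_add (k l : ℤ) : unitPow x (k + l) = unitPow x k * unitPow x l := by
  simp [unitPow, zpow_add]

@[simp]
theorem unitPow_zero : unitPow x 0 = 1 := by simp [unitPow]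

theorem unitPow_one_mul_neg_one : unitPow x 1 * unitPow x (-1) = 1 := by
  rw [← unitPow_add]; simp

/-- The weight of `y ^ k` in the linear functional that extracts the constant term in `y`
of a series divided by the kernel. -/
noncomputable def kernelWeight (Y : R⟦X⟧) (k : ℤ) : R⟦X⟧ :=
  if 0 ≤ k then Y ^ k.toNat else (unitPow x 1 * Y) ^ (-k).toNat

/-- The square root of the discriminant of the kernel that is determined by the root `Y`. -/
noncomputable def kernelSqrt (Y : R⟦X⟧) : R⟦X⟧ :=
  1 - X * (unitPow x 1 + unitPow x (-1)) - 2 * X * (1 + unitPow x 1) * Y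

variable {x} {Y : R⟦X⟧}

theorem kernelWeight_natCast (k : ℕ) : kernelWeight x Y k = Y ^ k := by
  simp [kernelWeight]

theorem kernelWeight_neg (k : ℕ) : kernelWeight x Y (-k) = (unitPow x 1 * Y) ^ k := by
  rcases k with _ | k
  · simp [kernelWeight]
  · rw [kernelWeight, if_neg (by omega)]
    simp

@[simp]
theorem kernelWeight_zero : kernelWeight x Y 0 = 1 := by simp [kernelWeight]

/-- The weight of y^k is √Δ times the constant term in y of y^k/K, where Δ is the discriminant. The
small root of K is Y and, as the product of the roots is x̄, the inverse of the other root is xY.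
Multiplying back by K leaves √Δ at k = 0 and nothing elsewhere. -/
theorem kernelWeight_recurrence
    (hY : Y = X * ((1 + unitPow x (-1)) + (unitPow x 1 + unitPow x (-1)) * Y +
      (1 + unitPow x 1) * Y ^ 2)) (k : ℤ) :
    X * ((unitPow x 1 + unitPow x (-1)) * kernelWeight x Y k +
      (1 + unitPow x 1) * kernelWeight x Y (k + 1) +
      (1 + unitPow x (-1)) * kernelWeight x Y (k - 1)) =
    kernelWeight x Y k - if k = 0 then kernelSqrt x Y else 0 := by
  have hx := unitPow_one_mul_neg_one x
  rcases lt_trichotomy k 0 with h | rfl | h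
  · obtain ⟨m, rfl⟩ : ∃ m : ℕ, k = -((m + 1 : ℕ) : ℤ) := ⟨(-k - 1).toNat, by omega⟩
    have e1 : -((m + 1 : ℕ) : ℤ) + 1 = -(m : ℤ) := by push_cast; ring
    have e2 : -((m + 1 : ℕ) : ℤ) - 1 = -((m + 2 : ℕ) : ℤ) := by push_cast; ring
    rw [e1, e2, kernelWeight_neg, kernelWeight_neg, kernelWeight_neg, if_neg (by omega)]
    generalize unitPow x 1 = a at *
    generalize unitPow x (-1) = b at *
    linear_combination (-(a * Y) ^ m * a) * hY + ((a * Y) ^ m * X * (a * Y ^ 2 - 1)) * hx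
  · have e1 : kernelWeight x Y (0 + 1) = Y := by simpa using kernelWeight_natCast (x := x) (Y := Y) 1
    have e2 : kernelWeight x Y (0 - 1) = unitPow x 1 * Y := by
      simpa using kernelWeight_neg (x := x) (Y := Y) 1
    rw [e1, e2, kernelWeight_zero, if_pos rfl, kernelSqrt]
    linear_combination X * Y * hx
  · obtain ⟨m, rfl⟩ : ∃ m : ℕ, k = ((m + 1 : ℕ) : ℤ) := ⟨(k - 1).toNat, by omega⟩
    have e1 : ((m + 1 : ℕ) : ℤ) + 1 = ((m + 2 : ℕ) : ℤ) := by push_cast; ring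
    have e2 : ((m + 1 : ℕ) : ℤ) - 1 = (m : ℤ) := by push_cast; ring
    rw [e1, e2, kernelWeight_natCast, kernelWeight_natCast, kernelWeight_natCast,
      if_neg (by omega)]
    linear_combination (-Y ^ m) * hY

variable (x Y) in
/-- The signed sum over half of the orbit of the monomial `x ^ (i + 1) * y ^ (j + 1)` under the
group of the model, with `kernelWeight` applied to the powers of `y`. -/
noncomputable def halfOrbit (p : ℤ × ℤ) : R⟦X⟧ :=
  unitPow x (p.1 + 1) * kernelWeight x Y (p.2 + 1)
    - unitPow x (-(p.1 + 1)) * kernelWeight x Y (p.2 - p.1)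
    + unitPow x (p.2 - p.1) * kernelWeight x Y (-(p.1 + 1))

theorem halfOrbit_neg_one_right (i : ℤ) : halfOrbit x Y (i, -1) = unitPow x (i + 1) := by
  have e : (-1 - i : ℤ) = -(i + 1) := by ring
  simp [halfOrbit, e]

theorem halfOrbit_neg_one_left (j : ℤ) : halfOrbit x Y (-1, j) = unitPow x (j + 1) := by
  simp [halfOrbit]

theorem X_mul_neighborSum_halfOrbit
    (hY : Y = X * ((1 + unitPow x (-1)) + (unitPow x 1 + unitPow x (-1)) * Y +
      (1 + unitPow x 1) * Y ^ 2)) (i j : ℕ) :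
    X * doubleKrewerasNeighborSum (halfOrbit x Y) i j =
      halfOrbit x Y (i, j) +
        if i = j then kernelSqrt x Y * unitPow x (-(i + 1)) else 0 := by
  have h1 := kernelWeight_recurrence hY (j + 1)
  have h2 := kernelWeight_recurrence hY (j - i)
  have h3 := kernelWeight_recurrence hY (-(i + 1))
  -- Here j + 1 > 0 and -(i + 1) < 0, so only the middle orbit term, with exponent j - i, can reach
  -- y^0. This is the source of the diagonal series.
  rw [if_neg (by omega)] at h1 h3
  have h4 : (if i = j then kernelSqrt x Y * unitPow x (-(i + 1)) else 0) =
      unitPow x (-(i + 1)) * if ((j : ℤ) - i = 0) then kernelSqrt x Y else 0 := by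
    by_cases h : i = j
    · subst h; simp [mul_comm]
    · rw [if_neg h, if_neg (by omega), mul_zero]
  rw [h4]
  simp only [doubleKrewerasNeighborSum, halfOrbit]
  have a2 : (i : ℤ) - 1 + 1 = (i + 1) + -1 := by ring
  have a3 : -((i : ℤ) + 1 + 1) = -(i + 1) + -1 := by ring
  have a4 : -((i : ℤ) + 1 + -1) = -(i + 1) + 1 := by ring
  have a5 : (j : ℤ) + 1 - i = (j - i) + 1 := by ring
  have a6 : (j : ℤ) - 1 - i = (j - i) + -1 := by ring
  have a7 : (j : ℤ) - (i + 1) = (j - i) + -1 := by ring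
  have a8 : (j : ℤ) - (i - 1) = (j - i) + 1 := by ring
  have a9 : (j : ℤ) + 1 - (i + 1) = j - i := by ring
  have a10 : (j : ℤ) - 1 - (i - 1) = j - i := by ring
  have a11 : (j : ℤ) - 1 + 1 = j + 1 + -1 := by ring
  simp only [a2, a3, a4, a5, a6, a7, a8, a9, a10, a11]
  rw [unitPow_add x (i + 1) 1, unitPow_add x (i + 1) (-1), unitPow_add x (-(i + 1)) 1,
    unitPow_add x (-(i + 1)) (-1), unitPow_add x (j - i) 1, unitPow_add x (j - i) (-1)]
  simp only [sub_eq_add_neg] at *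
  linear_combination unitPow x (i + 1) * h1 - unitPow x (-(i + 1)) * h2 +
    unitPow x (j + -i) * h3

/-- Multiply the n-th relation by X^n and sum: the left side telescopes, and the remainder X^k ψ k
tends to 0. -/
theorem eq_add_X_mul_of_forall_sub_eq {ψ : ℕ → R⟦X⟧} {a : R⟦X⟧} {u v : ℕ → R}
    (h : ∀ n, ψ n - X * ψ (n + 1) = a * C (u n) + X * C (v n)) :
    ψ 0 = a * PowerSeries.mk u + X * PowerSeries.mk v := by
  have hmk : ∀ (u : ℕ → R) (k : ℕ), PowerSeries.mk (fun n => u (n + k)) =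
      C (u k) + X * PowerSeries.mk (fun n => u (n + (k + 1))) := by
    intro u k
    ext n
    cases n with
    | zero => simp
    | succ n => simp [coeff_succ_X_mul, add_assoc, add_comm 1 k]
  have := PowerSeries.eq_zero_of_eq_X_mul
    (fun k => ψ k - (a * PowerSeries.mk (fun n => u (n + k)) +
      X * PowerSeries.mk (fun n => v (n + k)))) (fun k => by
        rw [hmk u k, hmk v k]
        linear_combination h k) 0
  simpa [sub_eq_zero] using this

variable (x) in
/-- Walks ending on the diagonal, counted by the powers of `x⁻¹`. -/
noncomputable def diagonalSeries : R⟦X⟧ :=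
  PowerSeries.mk fun n => walkSum doubleKrewerasSteps n
    fun p => if p.1 = p.2 then ((x ^ (-p.1) : Rˣ) : R) else 0

variable (x) in
/-- Walks ending on the horizontal axis, counted by the powers of `x`. -/
noncomputable def axisSeries : R⟦X⟧ :=
  PowerSeries.mk fun n => walkSum doubleKrewerasSteps n
    fun p => if p.2 = 0 then ((x ^ p.1 : Rˣ) : R) else 0

variable (R) in
/-- Walks ending at the origin. -/
noncomputable def excursionSeries : R⟦X⟧ :=
  PowerSeries.mk fun n => walkSum doubleKrewerasSteps n fun p => if p = 0 then (1 : R) else 0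

theorem half_orbit_equation
    (hY : Y = X * ((1 + unitPow x (-1)) + (unitPow x 1 + unitPow x (-1)) * Y +
      (1 + unitPow x 1) * Y ^ 2)) :
    2 * unitPow x 1 * Y - unitPow x (-1) =
      -(kernelSqrt x Y * unitPow x (-1)) * diagonalSeries x +
        X * (2 * (1 + unitPow x 1) * axisSeries x - excursionSeries R) := by
  have hrec : ∀ n, walkSum doubleKrewerasSteps n (halfOrbit x Y) -
      X * walkSum doubleKrewerasSteps (n + 1) (halfOrbit x Y) =
      -(kernelSqrt x Y * unitPow x (-1)) * C (walkSum doubleKrewerasSteps n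
        fun p => if p.1 = p.2 then ((x ^ (-p.1) : Rˣ) : R) else 0) +
      X * C (2 * (1 + (x : R)) * (walkSum doubleKrewerasSteps n
        fun p => if p.2 = 0 then ((x ^ p.1 : Rˣ) : R) else 0) -
        walkSum doubleKrewerasSteps n fun p => if p = 0 then (1 : R) else 0) := by
    intro n
    have hsw := walkSum_swap doubleKrewerasSteps swap_mem_doubleKrewerasSteps n
      (fun p => if p.2 = 0 then ((x ^ p.1 : Rˣ) : R) else 0)
    -- By diagonal symmetry both axes carry the same sum. Writing 2W as W + W' lets each copy match
    -- one boundary of the quadrant.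
    have h2 : ∀ W W' : R, W' = W → 2 * (1 + (x : R)) * W = (1 + (x : R)) * (W + W') := by
      rintro W _ rfl; ring
    rw [h2 _ _ hsw, walkSum_succ, ← walkSum_add, mul_walkSum, mul_walkSum, ← walkSum_sub,
      ← walkSum_sub, map_walkSum, map_walkSum, mul_walkSum, mul_walkSum, ← walkSum_add]
    refine walkSum_congr _ fun i j => ?_
    rw [stepSum_doubleKreweras, mul_add, mul_sub, mul_sub, X_mul_neighborSum_halfOrbit hY]
    simp only [halfOrbit_neg_one_right, halfOrbit_neg_one_left, sub_add_cancel, Prod.swap_prod_mk,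
      Prod.mk_eq_zero, Nat.cast_eq_zero, Nat.cast_inj, neg_add_cancel, unitPow_zero]
    have e1 : ∀ k : ℤ, C ((x ^ k : Rˣ) : R) = unitPow x k := fun _ => rfl
    have e2 : C (x : R) = unitPow x 1 := by simp [unitPow]
    simp only [map_sub, map_add, map_mul, map_one, apply_ite C, map_zero, e1, e2]
    have e3 : unitPow x (-((i : ℤ) + 1)) = unitPow x (-1) * unitPow x (-i) := by
      rw [← unitPow_add]; congr 1; ring
    rw [e3, unitPow_add, unitPow_add]
    split_ifs <;> ring
  have := eq_add_X_mul_of_forall_sub_eq hrec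
  rw [walkSum_zero] at this
  have h0 : halfOrbit x Y (0, 0) = 2 * unitPow x 1 * Y - unitPow x (-1) := by
    have e1 : kernelWeight x Y 1 = Y := by simpa using kernelWeight_natCast (x := x) (Y := Y) 1
    have e2 : kernelWeight x Y (-1) = unitPow x 1 * Y := by
      simpa using kernelWeight_neg (x := x) (Y := Y) 1
    simp only [halfOrbit, zero_add, sub_zero, kernelWeight_zero, unitPow_zero, e1, e2]
    ring
  rw [← h0, this]
  congr 2
  have e2 : unitPow x 1 = C (x : R) := by simp [unitPow]
  rw [e2]
  ext n
  have e3 : (2 : R⟦X⟧) * (1 + C (x : R)) = C (2 * (1 + (x : R))) := by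
    rw [map_mul, map_add, map_one, map_ofNat]
  rw [e3, map_sub, coeff_C_mul, axisSeries, excursionSeries, coeff_mk, coeff_mk, coeff_mk]

end KernelMethod

/-! ### Extraction of the nonnegative part in `x` -/

section Extraction

open PowerSeries

/-- Constants in `x`. -/
noncomputable def constIncl : ℚ⟦X⟧ →+* (Polynomial ℚ)⟦X⟧ := PowerSeries.map Polynomial.C

/-- Evaluation at `x = r`. -/
noncomputable def evalAt (r : ℚ) : (Polynomial ℚ)⟦X⟧ →+* ℚ⟦X⟧ :=
  PowerSeries.map (Polynomial.evalRingHom r)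

/-- The variable `x`. -/
noncomputable def polyVar : (Polynomial ℚ)⟦X⟧ := C Polynomial.X

/-- The inclusion of series in `t` with coefficients in `ℚ[x]` into those with coefficients in
`ℚ[x, x⁻¹]`. -/
noncomputable def posIncl : (Polynomial ℚ)⟦X⟧ →+* (LaurentPolynomial ℚ)⟦X⟧ :=
  PowerSeries.map Polynomial.toLaurent

/-- The substitution of `x⁻¹` for `x`. -/
noncomputable def negIncl : (Polynomial ℚ)⟦X⟧ →+* (LaurentPolynomial ℚ)⟦X⟧ :=
  PowerSeries.map ((LaurentPolynomial.invert (R := ℚ)).toRingHom.comp Polynomial.toLaurent)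

/-- The variable `x` as a unit of `ℚ[x, x⁻¹]`. -/
noncomputable def laurentVar : (LaurentPolynomial ℚ)ˣ where
  val := LaurentPolynomial.T 1
  inv := LaurentPolynomial.T (-1)
  val_inv := by rw [← LaurentPolynomial.T_add]; simp
  inv_val := by rw [← LaurentPolynomial.T_add]; simp

theorem laurentVar_zpow (k : ℤ) :
    ((laurentVar ^ k : (LaurentPolynomial ℚ)ˣ) : LaurentPolynomial ℚ) =
      LaurentPolynomial.T k := by
  have hnat : ∀ n : ℕ, ((laurentVar ^ n : (LaurentPolynomial ℚ)ˣ) : LaurentPolynomial ℚ) =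
      LaurentPolynomial.T n := by
    intro n
    rw [Units.val_pow_eq_pow_val]
    show (LaurentPolynomial.T 1 : LaurentPolynomial ℚ) ^ n = _
    rw [LaurentPolynomial.T_pow, mul_one]
  rcases Int.eq_nat_or_neg k with ⟨n, rfl | rfl⟩
  · rw [zpow_natCast, hnat]
  · rw [zpow_neg, zpow_natCast]
    refine Units.inv_eq_of_mul_eq_one_right ?_
    rw [hnat, ← LaurentPolynomial.T_add, add_neg_cancel, LaurentPolynomial.T_zero]

@[simp]
theorem evalAt_constIncl (r : ℚ) (f : ℚ⟦X⟧) : evalAt r (constIncl f) = f := by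
  ext n; simp [evalAt, constIncl]

@[simp]
theorem evalAt_polyVar (r : ℚ) : evalAt r polyVar = C r := by
  simp [evalAt, polyVar]

@[simp]
theorem evalAt_X (r : ℚ) : evalAt r X = X := by simp [evalAt]

@[simp]
theorem posIncl_X : posIncl X = X := by simp [posIncl]

@[simp]
theorem negIncl_X : negIncl X = X := by simp [negIncl]

theorem posIncl_polyVar : posIncl polyVar = unitPow laurentVar 1 := by
  rw [unitPow, laurentVar_zpow]; simp [posIncl, polyVar]

theorem negIncl_polyVar : negIncl polyVar = unitPow laurentVar (-1) := by
  rw [unitPow, laurentVar_zpow]; simp [negIncl, polyVar]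

theorem negIncl_constIncl (f : ℚ⟦X⟧) : negIncl (constIncl f) = posIncl (constIncl f) := by
  ext1 n; simp [negIncl, posIncl, constIncl]

theorem exists_eq_constIncl_add_polyVar_mul (F : (Polynomial ℚ)⟦X⟧) :
    ∃ G, F = constIncl (evalAt 0 F) + polyVar * G := by
  refine ⟨PowerSeries.mk fun n => (coeff n F).divX, ?_⟩
  ext1 n
  have h := Polynomial.divX_mul_X_add (coeff n F)
  rw [Polynomial.coeff_zero_eq_eval_zero] at h
  rw [map_add, polyVar, coeff_C_mul, coeff_mk]
  simp only [constIncl, evalAt, coeff_map, Polynomial.coe_evalRingHom]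
  rw [mul_comm, add_comm]
  exact h.symm

/-- Only nonnegative powers of x occur on the left and only negative ones on the right. -/
theorem eq_zero_of_posIncl_eq {p q : (Polynomial ℚ)⟦X⟧}
    (h : posIncl p = unitPow laurentVar (-1) * negIncl q) : p = 0 := by
  ext1 n
  have hn := congrArg (coeff n) h
  rw [unitPow, laurentVar_zpow, coeff_C_mul] at hn
  simp only [posIncl, negIncl, coeff_map] at hn
  rw [map_zero]
  ext k
  have hk := congrArg (fun f : LaurentPolynomial ℚ => f.coeff (k : ℤ)) hn
  generalize coeff n q = u at hk
  generalize coeff n p = v at hk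
  have h1 : (Polynomial.toLaurent v).coeff (k : ℤ) = v.coeff k :=
    Finsupp.mapDomain_apply Nat.castEmbedding.injective _ _
  have h2 : ∀ u : Polynomial ℚ, (LaurentPolynomial.T (-1) *
      LaurentPolynomial.invert (Polynomial.toLaurent u)).coeff (k : ℤ) = 0 := by
    intro u
    induction u using Polynomial.induction_on' with
    | add p q hp hq => rw [map_add, map_add, mul_add, AddMonoidAlgebra.coeff_add, Finsupp.add_apply, hp, hq, add_zero]
    | monomial m a =>
      rw [← Polynomial.C_mul_X_pow_eq_monomial, Polynomial.toLaurent_C_mul_X_pow, map_mul,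
        LaurentPolynomial.invert_C, LaurentPolynomial.invert_T, mul_left_comm,
        ← LaurentPolynomial.T_add, ← LaurentPolynomial.single_eq_C_mul_T]
      exact Finsupp.single_eq_of_ne (by omega)
  rw [Polynomial.coeff_zero, ← h1]
  exact hk.trans (h2 u)

/-- Walks ending on the horizontal axis, counted by the powers of `x`. -/
noncomputable def axisPolySeries : (Polynomial ℚ)⟦X⟧ :=
  PowerSeries.mk fun n => walkSum doubleKrewerasSteps n
    fun p => if p.2 = 0 then Polynomial.X ^ p.1.toNat else 0

/-- Walks ending on the diagonal, counted by the powers of `x`. -/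
noncomputable def diagonalPolySeries : (Polynomial ℚ)⟦X⟧ :=
  PowerSeries.mk fun n => walkSum doubleKrewerasSteps n
    fun p => if p.1 = p.2 then Polynomial.X ^ p.1.toNat else 0

theorem posIncl_axisPolySeries : posIncl axisPolySeries = axisSeries laurentVar := by
  ext1 n
  rw [posIncl, coeff_map, axisPolySeries, axisSeries, coeff_mk, coeff_mk, map_walkSum]
  refine walkSum_congr _ fun i j => ?_
  rw [laurentVar_zpow]
  by_cases h : j = 0 <;> simp [h]

theorem negIncl_diagonalPolySeries :
    negIncl diagonalPolySeries = diagonalSeries laurentVar := by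
  ext1 n
  rw [negIncl, coeff_map, diagonalPolySeries, diagonalSeries, coeff_mk, coeff_mk, map_walkSum]
  refine walkSum_congr _ fun i j => ?_
  rw [laurentVar_zpow]
  by_cases h : i = j <;> simp [h]

theorem posIncl_constIncl_excursionSeries :
    posIncl (constIncl (excursionSeries ℚ)) = excursionSeries (LaurentPolynomial ℚ) := by
  ext1 n
  rw [posIncl, constIncl, coeff_map, coeff_map, excursionSeries, excursionSeries, coeff_mk,
    coeff_mk, map_walkSum, map_walkSum]
  refine walkSum_congr _ fun i j => ?_
  simp [apply_ite]

theorem evalAt_zero_diagonalPolySeries : evalAt 0 diagonalPolySeries = excursionSeries ℚ := by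
  ext1 n
  rw [evalAt, coeff_map, diagonalPolySeries, excursionSeries, coeff_mk, coeff_mk, map_walkSum]
  refine walkSum_congr _ fun i j => ?_
  by_cases h : i = j
  · subst h
    by_cases h0 : i = 0 <;> simp [h0]
  · have : ¬ (i = 0 ∧ j = 0) := by omega
    simp [h, this]

theorem axis_equation {c a b : ℚ⟦X⟧} {P : (Polynomial ℚ)⟦X⟧} {Y : (LaurentPolynomial ℚ)⟦X⟧}
    (hY : Y = X * ((1 + unitPow laurentVar (-1)) +
      (unitPow laurentVar 1 + unitPow laurentVar (-1)) * Y + (1 + unitPow laurentVar 1) * Y ^ 2))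
    (hP : P ^ 2 = 1 + constIncl a * polyVar + constIncl b * polyVar ^ 2)
    (hP1 : constantCoeff P = 1)
    (hfac : kernelSqrt laurentVar Y = posIncl (constIncl c) * posIncl P * negIncl P) :
    ∃ d : ℚ⟦X⟧, 2 * d = a ∧
      constIncl c * (polyVar + constIncl d - X * constIncl (excursionSeries ℚ)) * P * polyVar =
        polyVar ^ 2 - X * polyVar ^ 3 - 2 * X * polyVar - X
          - polyVar * (1 + polyVar) * X * (2 * X * (1 + polyVar) * axisPolySeries
            - X * constIncl (excursionSeries ℚ)) + X * P := by
  obtain ⟨P1, hP1x⟩ := exists_eq_constIncl_add_polyVar_mul P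
  have hp0 : evalAt 0 P = 1 := by
    refine PowerSeries.eq_of_sq_eq_sq ?_ ?_ (by simp)
    · rw [← map_pow, hP]; simp
    · rw [evalAt, constantCoeff_map_apply, hP1, map_one]
  rw [hp0, map_one] at hP1x
  have hx0 : polyVar ≠ 0 := by
    intro h
    have := congrArg (evalAt 1) h
    simp at this
  have hP1' : 2 * P1 + polyVar * P1 ^ 2 = constIncl a + constIncl b * polyVar := by
    refine mul_left_cancel₀ hx0 ?_
    rw [hP1x] at hP
    linear_combination hP
  obtain ⟨P2, hP2x⟩ := exists_eq_constIncl_add_polyVar_mul P1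
  set d := evalAt 0 P1 with hd
  refine ⟨d, ?_, ?_⟩
  · have := congrArg (evalAt 0) hP1'
    simpa [map_ofNat] using this
  obtain ⟨D1, hD1⟩ := exists_eq_constIncl_add_polyVar_mul diagonalPolySeries
  rw [evalAt_zero_diagonalPolySeries] at hD1
  obtain ⟨Pi, hPi⟩ : ∃ Pi, P * Pi = 1 := by
    have hu : IsUnit P := by
      rw [PowerSeries.isUnit_iff_constantCoeff, hP1]; exact isUnit_one
    exact hu.exists_right_inv
  have hhalf := half_orbit_equation hY
  rw [← posIncl_axisPolySeries, ← posIncl_constIncl_excursionSeries,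
    ← negIncl_diagonalPolySeries] at hhalf
  have hks : 2 * X * (1 + unitPow laurentVar 1) * Y =
      1 - X * (unitPow laurentVar 1 + unitPow laurentVar (-1)) - kernelSqrt laurentVar Y := by
    rw [kernelSqrt]; ring
  have hxy := unitPow_one_mul_neg_one laurentVar
  set E := excursionSeries ℚ
  have key : constIncl c * (polyVar + constIncl d - X * constIncl E)
      - Pi * (polyVar - X * polyVar ^ 2 - 2 * X - (1 + polyVar) * X *
        (2 * X * (1 + polyVar) * axisPolySeries - X * constIncl E)) - X * P1 * Pi = 0 := by
    -- The half-orbit equation, freed of Y and divided by P(x), is sorted by the sign of the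
    -- exponent of x. The witness q collects what is left over in negative powers.
    refine eq_zero_of_posIncl_eq (q := -(X + constIncl c * (P2 - X * (P * (1 + polyVar) * D1 +
      constIncl E * (P1 * (1 + polyVar) + 1))))) ?_
    have e1 := congrArg posIncl hP1x
    have e2 := congrArg negIncl hP1x
    have e3 := congrArg negIncl hP2x
    have e4 := congrArg negIncl hD1
    have e5 := congrArg posIncl hPi
    simp only [map_add, map_sub, map_mul, map_one, map_neg, map_pow, map_ofNat, posIncl_X,
      negIncl_X, posIncl_polyVar, negIncl_polyVar, negIncl_constIncl] at e1 e2 e3 e4 e5 ⊢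
    rw [hfac] at hks hhalf
    generalize unitPow laurentVar 1 = x at *
    generalize unitPow laurentVar (-1) = y at *
    generalize posIncl P = Pp at *
    generalize negIncl P = M at *
    generalize posIncl P1 = Q1 at *
    generalize negIncl P1 = M1 at *
    generalize negIncl P2 = M2 at *
    generalize posIncl Pi = I at *
    generalize posIncl (constIncl c) = k at *
    generalize posIncl (constIncl d) = δ at *
    generalize posIncl (constIncl E) = e at *
    generalize posIncl axisPolySeries = A at *
    generalize negIncl diagonalPolySeries = D at *
    generalize negIncl D1 = D1' at *
    have hK : k * Pp * M * (x - X * (1 + y) * D) =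
        x - X * x ^ 2 - 2 * X - X * y - (1 + x) * X * (2 * X * (1 + x) * A - X * e) := by
      linear_combination (-X * (1 + x)) * hhalf + x * hks + (k * Pp * M * X * D - 2 * X) * hxy
    have hK1 : k * M * (x - X * (1 + y) * D) = I *
        (x - X * x ^ 2 - 2 * X - X * y - (1 + x) * X * (2 * X * (1 + x) * A - X * e)) := by
      linear_combination I * hK - k * M * (x - X * (1 + y) * D) * e5
    have hM : M = 1 + δ * y + y ^ 2 * M2 := by linear_combination e2 + y * e3
    have hMx : M * x = x + δ + y * M2 := by linear_combination x * hM + (δ + y * M2) * hxy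
    have hMD : M * (1 + y) * D = e + y * (M * (1 + y) * D1' + e * (M1 * (1 + y) + 1)) := by
      linear_combination M * (1 + y) * e4 + e * (1 + y) * e2
    -- The only product mixing x̄ with 1/P(x). Since P = 1 + x P1, it splits as x̄/P = x̄ - P1/P.
    have hI : I * (X * y) = X * y - X * Q1 * I := by
      linear_combination X * y * e5 - X * y * I * e1 - X * Q1 * I * hxy
    linear_combination hK1 - k * hMx + k * X * hMD - hI
  linear_combination P * polyVar * key + (polyVar * (polyVar - X * polyVar ^ 2 - 2 * X -
    (1 + polyVar) * X * (2 * X * (1 + polyVar) * axisPolySeries - X * constIncl E))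
      + X * polyVar * P1) * hPi - X * hP1x

end Extraction

/-! ### Explicit solution -/

section Solution

open PowerSeries

theorem quadrantGFAt_zero_zero :
    quadrantGFAt doubleKrewerasSteps 0 0 = excursionSeries ℚ := by
  ext1 n
  rw [coeff_quadrantGFAt, excursionSeries, coeff_mk]
  refine walkSum_congr _ fun i j => ?_
  by_cases hi : i = 0 <;> by_cases hj : j = 0 <;> simp [hi, hj]

theorem quadrantGFAt_one_one_equation :
    (1 - 6 * X) * quadrantGFAt doubleKrewerasSteps 1 1 =
      1 - 4 * X * evalAt 1 axisPolySeries + X * excursionSeries ℚ := by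
  have hrec : ∀ n, walkSum doubleKrewerasSteps (n + 1) (fun _ => (1 : ℚ)) =
      6 * walkSum doubleKrewerasSteps n (fun _ => (1 : ℚ)) -
        4 * (walkSum doubleKrewerasSteps n fun p => if p.2 = 0 then (1 : ℚ) else 0) +
        walkSum doubleKrewerasSteps n fun p => if p = 0 then (1 : ℚ) else 0 := by
    intro n
    have hsw := walkSum_swap doubleKrewerasSteps swap_mem_doubleKrewerasSteps n
      (fun p => if p.2 = 0 then (1 : ℚ) else 0)
    have h2 : ∀ W W' : ℚ, W' = W → 4 * W = 2 * (W + W') := by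
      rintro W _ rfl; ring
    rw [h2 _ _ hsw, walkSum_succ, ← walkSum_add, mul_walkSum, mul_walkSum, ← walkSum_sub,
      ← walkSum_add]
    refine walkSum_congr _ fun i j => ?_
    rw [stepSum_doubleKreweras]
    simp only [doubleKrewerasNeighborSum, Prod.swap_prod_mk, Prod.mk_eq_zero, Nat.cast_eq_zero]
    split_ifs <;> norm_num
  have hcoe : ∀ n, coeff n (quadrantGFAt doubleKrewerasSteps 1 1) =
      walkSum doubleKrewerasSteps n (fun _ => (1 : ℚ)) := by
    intro n
    rw [coeff_quadrantGFAt]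
    exact walkSum_congr _ fun i j => by simp
  have hax : ∀ n, coeff n (evalAt 1 axisPolySeries) =
      walkSum doubleKrewerasSteps n fun p => if p.2 = 0 then (1 : ℚ) else 0 := by
    intro n
    rw [evalAt, coeff_map, axisPolySeries, coeff_mk, map_walkSum]
    exact walkSum_congr _ fun i j => by by_cases h : j = 0 <;> simp [h]
  have h6 : (6 : ℚ⟦X⟧) = C 6 := (map_ofNat C 6).symm
  have h4 : (4 : ℚ⟦X⟧) = C 4 := (map_ofNat C 4).symm
  have : quadrantGFAt doubleKrewerasSteps 1 1 = 1 + X * (C 6 * quadrantGFAt doubleKrewerasSteps 1 1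
      - C 4 * evalAt 1 axisPolySeries + excursionSeries ℚ) := by
    ext1 n
    rcases n with _ | n
    · rw [hcoe, walkSum_zero]; simp
    · rw [hcoe, hrec, map_add, coeff_succ_X_mul, map_add, map_sub, coeff_C_mul, coeff_C_mul, hcoe,
        hax, excursionSeries, coeff_mk, coeff_one, if_neg (Nat.succ_ne_zero _), zero_add]
  rw [h6, h4]
  linear_combination this

variable {N : ℚ⟦X⟧}

theorem constantCoeff_eq_zero_of_fixedPoint (hN : N = X * (1 + 2 * N + 4 * N ^ 2)) :
    constantCoeff N = 0 := by
  rw [hN]; simp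

theorem ne_zero_of_fixedPoint (hN : N = X * (1 + 2 * N + 4 * N ^ 2)) : N ≠ 0 := by
  rintro rfl
  exact (X_ne_zero : (X : ℚ⟦X⟧) ≠ 0) (by simpa using hN.symm)

/-- The discriminant of the kernel factors as a product of a constant, of a series in `ℚ[x]⟦t⟧` and
of a series in `ℚ[x⁻¹]⟦t⟧`. -/
theorem kernelSqrt_factorization {J c a b : ℚ⟦X⟧} {P : (Polynomial ℚ)⟦X⟧}
    {Y : (LaurentPolynomial ℚ)⟦X⟧} (hN : N = X * (1 + 2 * N + 4 * N ^ 2)) (hJ : N = J ^ 2 - J)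
    (hc : c * (1 + 2 * N + 4 * N ^ 2) = J ^ 2)
    (ha : J ^ 2 * a = -2 * N * (J ^ 2 + (J - 1) ^ 2)) (hb : J ^ 2 * b = (J - 1) ^ 2)
    (hJ1 : constantCoeff J = 1)
    (hY : Y = X * ((1 + unitPow laurentVar (-1)) +
      (unitPow laurentVar 1 + unitPow laurentVar (-1)) * Y + (1 + unitPow laurentVar 1) * Y ^ 2))
    (hP : P ^ 2 = 1 + constIncl a * polyVar + constIncl b * polyVar ^ 2)
    (hP1 : constantCoeff P = 1) :
    kernelSqrt laurentVar Y = posIncl (constIncl c) * posIncl P * negIncl P := by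
  have hN0 := constantCoeff_eq_zero_of_fixedPoint hN
  have hc1 : constantCoeff c = 1 := by
    have := congrArg constantCoeff hc
    simpa [hN0, hJ1] using this
  have : CharZero (LaurentPolynomial ℚ) := algebraRat.charZero _
  refine PowerSeries.eq_of_sq_eq_sq ?_ ?_ ?_
  · have hxy := unitPow_one_mul_neg_one laurentVar
    have e1 := congrArg posIncl hP
    have e2 := congrArg negIncl hP
    have f := fun {u v : ℚ⟦X⟧} (h : u = v) => congrArg (posIncl.comp constIncl) h
    have g1 := f hN
    have g2 := f hJ
    have g3 := f hc
    have g4 := f ha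
    have g5 := f hb
    have hX : constIncl X = X := by simp [constIncl]
    have hD : posIncl (constIncl (1 + 2 * N + 4 * N ^ 2)) ≠ 0 := by
      intro h
      have := congrArg (constantCoeff (R := LaurentPolynomial ℚ)) h
      simp [posIncl, constIncl, constantCoeff_map_apply, hN0] at this
    simp only [RingHom.comp_apply, map_add, map_sub, map_mul, map_one, map_neg, map_pow, map_ofNat,
      hX, posIncl_X, posIncl_polyVar, negIncl_polyVar, negIncl_constIncl]
      at e1 e2 g1 g2 g3 g4 g5 hD
    rw [kernelSqrt, mul_pow, mul_pow, e1, e2]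
    generalize unitPow laurentVar 1 = x at *
    generalize unitPow laurentVar (-1) = y at *
    generalize posIncl (constIncl c) = c' at *
    generalize posIncl (constIncl N) = n at *
    generalize posIncl (constIncl J) = j at *
    generalize posIncl (constIncl a) = a' at *
    generalize posIncl (constIncl b) = b' at *
    -- The quadratic equation of Y turns the square of `kernelSqrt` into the discriminant of K, in
    -- which Y no longer occurs.
    have hl : (1 - X * (x + y) - 2 * X * (1 + x) * Y) ^ 2 =
        (1 - X * (x + y)) ^ 2 - 4 * X ^ 2 * (2 + (x + y)) := by
      linear_combination (-4 * X * (1 + x)) * hY - 4 * X ^ 2 * hxy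
    rw [hl]
    refine mul_left_cancel₀ (pow_ne_zero 2 hD) ?_
    have l1 : (1 + 2 * n + 4 * n ^ 2) ^ 2 *
        ((1 - X * (x + y)) ^ 2 - 4 * X ^ 2 * (2 + (x + y))) =
        ((1 + 2 * n + 4 * n ^ 2) - n * (x + y)) ^ 2 - 4 * n ^ 2 * (2 + (x + y)) := by
      have : X * (1 + 2 * n + 4 * n ^ 2) = n := g1.symm
      generalize 1 + 2 * n + 4 * n ^ 2 = D at this ⊢
      rw [← this]; ring
    have l2 : (1 + 2 * n + 4 * n ^ 2) ^ 2 *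
        (c' ^ 2 * (1 + a' * x + b' * x ^ 2) * (1 + a' * y + b' * y ^ 2)) =
        (j ^ 2 + j ^ 2 * a' * x + j ^ 2 * b' * x ^ 2) *
          (j ^ 2 + j ^ 2 * a' * y + j ^ 2 * b' * y ^ 2) := by
      generalize 1 + 2 * n + 4 * n ^ 2 = D at g3 ⊢
      have : D ^ 2 * c' ^ 2 = j ^ 2 * j ^ 2 := by rw [← g3]; ring
      linear_combination (1 + a' * x + b' * x ^ 2) * (1 + a' * y + b' * y ^ 2) * this
    rw [l1, l2, g4, g5, g2]
    set α := -2 * (j ^ 2 - j) * (j ^ 2 + (j - 1) ^ 2) with hα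
    set β := (j - 1) ^ 2 with hβ
    linear_combination (-(α ^ 2 + α * β * (x + y) + β ^ 2 * (x * y + 1)
      - 2 * (j ^ 2 - j) ^ 2)) * hxy
  · simp [kernelSqrt]
  · simp [posIncl, negIncl, constIncl, constantCoeff_map_apply, hc1, hP1]

theorem exists_quadratic_parameter (hN : constantCoeff N = 0) :
    ∃ J : ℚ⟦X⟧, N = J ^ 2 - J ∧ constantCoeff J = 1 := by
  obtain ⟨V, hV, hV1⟩ := PowerSeries.exists_sqrt (R := ℚ) (F := 1 + 4 * N) (by simp [hN])
  have h2 : (2 : ℚ⟦X⟧) * C (1 / 2) = 1 := by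
    rw [← map_ofNat C 2, ← map_mul]; norm_num
  -- J = (1 + √(1+4N))/2, the root of J² - J = N with constant term 1.
  refine ⟨C (1 / 2) * (1 + V), ?_, ?_⟩
  · have : CharZero ℚ⟦X⟧ := algebraRat.charZero _
    have h4 : (4 : ℚ⟦X⟧) ≠ 0 := by norm_num
    refine mul_left_cancel₀ h4 ?_
    linear_combination -hV - (2 * C (1 / 2) * (1 + V) ^ 2 + (1 + V) ^ 2 - 2 * (1 + V)) * h2
  · rw [map_mul, map_add, hV1]; norm_num

/-- The generating functions of excursions and of all walks, in terms of the parameter `J`. -/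
theorem excursion_and_total_equations {J : ℚ⟦X⟧} (hN : N = X * (1 + 2 * N + 4 * N ^ 2))
    (hJ : N = J ^ 2 - J) (hJ1 : constantCoeff J = 1) :
    J * (X * excursionSeries ℚ) = (1 + 2 * N) * (2 - J) - 1 ∧
      (1 - 2 * N) * (1 + 2 * X * quadrantGFAt doubleKrewerasSteps 1 1) ^ 2 = 1 + 2 * N := by
  have hN0 := constantCoeff_eq_zero_of_fixedPoint hN
  have hJJ : J * J⁻¹ = 1 := PowerSeries.mul_inv_cancel _ (by rw [hJ1]; exact one_ne_zero)
  have hD1 : constantCoeff (1 + 2 * N + 4 * N ^ 2) = 1 := by simp [hN0]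
  have hDD : (1 + 2 * N + 4 * N ^ 2) * (1 + 2 * N + 4 * N ^ 2)⁻¹ = 1 :=
    PowerSeries.mul_inv_cancel _ (by rw [hD1]; exact one_ne_zero)
  set D := 1 + 2 * N + 4 * N ^ 2 with hD
  have hn1 : 1 + 2 * N = J ^ 2 + (J - 1) ^ 2 := by rw [hJ]; ring
  obtain ⟨c, hc⟩ : ∃ c, c * D = J ^ 2 := ⟨J ^ 2 * D⁻¹, by linear_combination J ^ 2 * hDD⟩
  obtain ⟨b, hb⟩ : ∃ b, J ^ 2 * b = (J - 1) ^ 2 :=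
    ⟨((J - 1) * J⁻¹) ^ 2, by linear_combination (J - 1) ^ 2 * (J * J⁻¹ + 1) * hJJ⟩
  obtain ⟨a, ha⟩ : ∃ a, J ^ 2 * a = -2 * N * (J ^ 2 + (J - 1) ^ 2) :=
    ⟨-2 * N * (1 + b), by linear_combination (-2 * N) * hb⟩
  have ha0 : constantCoeff a = 0 := by simpa [hN0, hJ1] using congrArg constantCoeff ha
  have hb0 : constantCoeff b = 0 := by simpa [hJ1] using congrArg constantCoeff hb
  obtain ⟨P, hP, hP1⟩ := PowerSeries.exists_sqrt
    (F := 1 + constIncl a * polyVar + constIncl b * polyVar ^ 2)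
    (by simp [constIncl, constantCoeff_map_apply, ha0, hb0])
  obtain ⟨Y, hY⟩ := PowerSeries.exists_quadratic_fixedPoint
    (1 + unitPow laurentVar (-1)) (unitPow laurentVar 1 + unitPow laurentVar (-1))
    (1 + unitPow laurentVar 1)
  obtain ⟨d, hd, hax⟩ := axis_equation hY hP hP1
    (kernelSqrt_factorization hN hJ hc ha hb hJ1 hY hP hP1)
  have hev : ∀ r, constantCoeff (evalAt r P) = 1 := by
    intro r
    rw [evalAt, constantCoeff_map_apply, hP1, map_one]
  have htot := quadrantGFAt_one_one_equation
  -- At x = -1 the factor 1 + x kills the axis series, leaving an equation for the excursions alone.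
  have hm := congrArg (evalAt (-1)) hax
  have hp := congrArg (evalAt 1) hax
  have hPm := congrArg (evalAt (-1)) hP
  have hPp := congrArg (evalAt 1) hP
  simp only [map_add, map_sub, map_mul, map_one, map_pow, map_neg, map_ofNat, evalAt_constIncl,
    evalAt_polyVar, evalAt_X] at hm hp hPm hPp
  have hPm' : J * evalAt (-1) P = 1 + 2 * N := by
    refine PowerSeries.eq_of_sq_eq_sq ?_ ?_ ?_
    · linear_combination J ^ 2 * hPm - ha + hb - (2 * N + (1 + 2 * N)) * hn1 + 4 * N * hJ
    · rw [map_mul, hJ1, hev, one_mul]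
    · simp [hN0]
  have hPp' : (J * evalAt 1 P) ^ 2 = (1 + 2 * N) * (1 - 2 * N) := by
    linear_combination J ^ 2 * hPp + ha + hb + (4 * N - 2) * hJ
  have hdJ : J ^ 2 * d = -N * (1 + 2 * N) := by
    have : CharZero ℚ⟦X⟧ := algebraRat.charZero _
    have h2 : (2 : ℚ⟦X⟧) ≠ 0 := two_ne_zero
    refine mul_left_cancel₀ h2 ?_
    linear_combination J ^ 2 * hd + ha + 2 * N * hn1
  have hNX : X * D = N := hN.symm
  have hJ0 : J ≠ 0 := left_ne_zero_of_mul_eq_one hJJ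
  generalize evalAt (-1) P = Pm at *
  generalize evalAt 1 P = Pp at *
  generalize evalAt 1 axisPolySeries = A at *
  generalize quadrantGFAt doubleKrewerasSteps 1 1 = Q at *
  generalize excursionSeries ℚ = E at *
  have hE : J * (X * E) = (1 + 2 * N) * (2 - J) - 1 := by
    have hne : 1 + 2 * N ≠ 0 := by
      intro h
      have := congrArg constantCoeff h
      simp [hN0] at this
    have h1 : J ^ 2 * (1 - d + X * E) * (1 + 2 * N) = (1 + 2 * N) ^ 2 * J + N * (1 + 2 * N) := by
      have h0 : c * (1 - d + X * E) * Pm = 1 + 2 * X + X * Pm := by linear_combination hm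
      linear_combination D * J * h0 - (1 - d + X * E) * J * Pm * hc
        + (N - (1 - d + X * E) * J ^ 2) * hPm' + (2 * J + J * Pm) * hNX + J * hD
    have h2 : J ^ 2 * (1 - d + X * E) = (1 + 2 * N) * J + N :=
      mul_left_cancel₀ hne (by linear_combination h1)
    refine mul_left_cancel₀ hJ0 ?_
    linear_combination h2 + hdJ - 2 * N * hJ
  refine ⟨hE, ?_⟩
  have h0 : (1 - 6 * X) * (1 + 2 * X * Q) = Pp * (c * (1 + d - X * E) - X) := by
    linear_combination -hp + 2 * X * htot
  have hne : 1 - 2 * N ≠ 0 := by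
    intro h
    have := congrArg constantCoeff h
    simp [hN0] at this
  -- Since X D = N, one has (1 - 6X) D = (1 - 2N)², and one factor 1 - 2N cancels.
  have h1 : (1 - 2 * N) * (1 + 2 * X * Q) = J * Pp := by
    refine mul_left_cancel₀ hne ?_
    have h3 : J ^ 2 * (1 + d - X * E) - N = J * (1 - 2 * N) := by
      linear_combination hdJ - J * hE - (2 + 2 * N) * hJ
    linear_combination D * h0 + (6 * (1 + 2 * X * Q) - Pp) * hNX - (1 + 2 * X * Q) * hD
      + Pp * (1 + d - X * E) * hc + Pp * h3
  refine mul_left_cancel₀ hne ?_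
  rw [← h1] at hPp'
  linear_combination hPp'

theorem coe_eq_of_total_equation {F G : ℚ⟦X⟧} (h : 1 + 2 * X * F = G) :
    (F : ℚ⸨X⸩) = 1 / (2 * ((X : ℚ⟦X⟧) : ℚ⸨X⸩)) * ((G : ℚ⸨X⸩) - 1) := by
  have h' := congrArg (HahnSeries.ofPowerSeries ℤ ℚ) h
  have : CharZero ℚ⸨X⸩ := algebraRat.charZero _
  have h2 : (2 : ℚ⸨X⸩) ≠ 0 := two_ne_zero
  have hX : HahnSeries.ofPowerSeries ℤ ℚ X ≠ 0 :=
    (map_ne_zero_iff _ HahnSeries.ofPowerSeries_injective).mpr X_ne_zero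
  rw [map_add, map_mul, map_mul, map_one, map_ofNat] at h'
  rw [← h']
  field_simp
  ring

theorem coe_eq_of_excursion_equation {E G : ℚ⟦X⟧} (hN : N ≠ 0)
    (h : 2 * N * X ^ 2 * E = X * G - N - 4 * N * X) :
    (E : ℚ⸨X⸩) = (G : ℚ⸨X⸩) / (2 * (N : ℚ⸨X⸩) * ((X : ℚ⟦X⟧) : ℚ⸨X⸩))
      - 1 / (2 * ((X : ℚ⟦X⟧) : ℚ⸨X⸩) ^ 2) - 2 / ((X : ℚ⟦X⟧) : ℚ⸨X⸩) := by
  have h' := congrArg (HahnSeries.ofPowerSeries ℤ ℚ) h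
  have : CharZero ℚ⸨X⸩ := algebraRat.charZero _
  have h2 : (2 : ℚ⸨X⸩) ≠ 0 := two_ne_zero
  have hX : HahnSeries.ofPowerSeries ℤ ℚ X ≠ 0 :=
    (map_ne_zero_iff _ HahnSeries.ofPowerSeries_injective).mpr X_ne_zero
  have hN' : HahnSeries.ofPowerSeries ℤ ℚ N ≠ 0 :=
    (map_ne_zero_iff _ HahnSeries.ofPowerSeries_injective).mpr hN
  simp only [map_sub, map_mul, map_pow, map_ofNat] at h'
  generalize HahnSeries.ofPowerSeries ℤ ℚ X = t at *
  generalize HahnSeries.ofPowerSeries ℤ ℚ N = n at *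
  field_simp
  linear_combination h'

end Solution

/-! ### Assembly of the closed forms -/

theorem mainTheorem10 :
    (∃! N : ℚ⟦X⟧, N = PowerSeries.X * (1 + 2 * N + 4 * N ^ 2)) ∧
    ∀ N : ℚ⟦X⟧, N = PowerSeries.X * (1 + 2 * N + 4 * N ^ 2) →
      N = PowerSeries.X * PowerSeries.mk (fun n : ℕ => (2 : ℚ) ^ n * (motzkin n : ℚ)) ∧
      N = PowerSeries.X * PowerSeries.mk (fun n : ℕ =>
        ∑ k ∈ Finset.range (n / 2 + 1),
          (2 : ℚ) ^ n / ((k : ℚ) + 1) * (n.choose (2 * k) : ℚ) * ((2 * k).choose k : ℚ)) ∧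
      ((quadrantGFAt doubleKrewerasSteps 1 1 : ℚ⟦X⟧) : ℚ⸨X⸩) =
        1 / (2 * ((PowerSeries.X : ℚ⟦X⟧) : ℚ⸨X⸩)) *
          ((powerSeriesSqrt ((1 + 2 * N) * (1 - 2 * N)⁻¹) : ℚ⸨X⸩) - 1) ∧
      ((quadrantGFAt doubleKrewerasSteps 0 0 : ℚ⟦X⟧) : ℚ⸨X⸩) =
        (powerSeriesRPow (1 + 4 * N) (3 / 2) : ℚ⸨X⸩) /
            (2 * (N : ℚ⸨X⸩) * ((PowerSeries.X : ℚ⟦X⟧) : ℚ⸨X⸩))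
          - 1 / (2 * ((PowerSeries.X : ℚ⟦X⟧) : ℚ⸨X⸩) ^ 2)
          - 2 / ((PowerSeries.X : ℚ⟦X⟧) : ℚ⸨X⸩) := by
  have hM := X_mul_motzkinSeries_fixedPoint
  refine ⟨⟨_, hM, fun N hN => PowerSeries.quadratic_fixedPoint_unique hN hM⟩, fun N hN => ?_⟩
  have hNM := PowerSeries.quadratic_fixedPoint_unique hN hM
  have hN0 := constantCoeff_eq_zero_of_fixedPoint hN
  obtain ⟨J, hJ, hJ1⟩ := exists_quadratic_parameter hN0
  obtain ⟨hE, hQ⟩ := excursion_and_total_equations hN hJ hJ1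
  refine ⟨hNM, ?_, ?_, ?_⟩
  · rw [mk_closedForm_eq_motzkinSeries]
    exact hNM
  · refine coe_eq_of_total_equation ?_
    have hc : PowerSeries.constantCoeff (1 - 2 * N) = 1 := by simp [hN0]
    have hinv : (1 - 2 * N) * (1 - 2 * N)⁻¹ = 1 :=
      PowerSeries.mul_inv_cancel _ (by rw [hc]; exact one_ne_zero)
    have h1 : PowerSeries.constantCoeff ((1 + 2 * N) * (1 - 2 * N)⁻¹) = 1 := by
      simp [hN0]
    refine PowerSeries.eq_of_sq_eq_sq ?_ (by simp) (constantCoeff_powerSeriesRPow h1 _)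
    rw [powerSeriesSqrt, powerSeriesRPow_sq h1 (d := 1) (by norm_num), pow_one]
    linear_combination (1 - 2 * N)⁻¹ * hQ -
      (1 + 2 * PowerSeries.X * quadrantGFAt doubleKrewerasSteps 1 1) ^ 2 * hinv
  · refine coe_eq_of_excursion_equation (ne_zero_of_fixedPoint hN) ?_
    have h1 : PowerSeries.constantCoeff (1 + 4 * N) = 1 := by simp [hN0]
    -- N = J² - J gives 1 + 4N = (2J - 1)², and the constant term 1 fixes the sign of the root.
    have hG : powerSeriesRPow (1 + 4 * N) (3 / 2) = (2 * J - 1) ^ 3 := by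
      refine PowerSeries.eq_of_sq_eq_sq ?_ (constantCoeff_powerSeriesRPow h1 _) ?_
      · rw [powerSeriesRPow_sq h1 (d := 3) (by norm_num), hJ]
        ring
      · rw [map_pow, map_sub, map_mul, hJ1, map_ofNat, map_one]
        norm_num
    rw [hG, quadrantGFAt_zero_zero]
    have h2 : 2 * N * (PowerSeries.X * excursionSeries ℚ) =
        (2 * J - 1) ^ 3 - (1 + 2 * N + 4 * N ^ 2) - 4 * N := by
      have h3 : 2 * N * (PowerSeries.X * excursionSeries ℚ) =
          2 * (J - 1) * (J * (PowerSeries.X * excursionSeries ℚ)) := by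
        linear_combination 2 * (PowerSeries.X * excursionSeries ℚ) * hJ
      rw [h3, hE, hJ]
      ring
    linear_combination PowerSeries.X * h2 + hN
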